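/- Let $G$ be a Polish group and let $X$ be a nonempty Polish $G$-space, that is, a nonempty Polish space with a continuous action $G\times X\to X$. For $x\in X$ write $[x]$ for the $G$-orbit of $x$, and let $E^G_X$ be the orbit equivalence relation on $X$: $x\,E^G_X\,x'$ if and only if $[x]=[x']$. For an open neighbourhood $V$ of the identity of $G$ and $x,y\in X$, write $x\succeq_V y$ if there are $g_*\in G$ and a sequence $(g_n)$ of elements of $V$ such that $g_n g_* x\to y$ as $n\to\infty$. Assume that for every open neighbourhood $V$ of the identity of $G$, every $G$-invariant comeager set $C\subseteq X$ and every non-meager set $O\subseteq X$ there are $c\in C$ and $o\in O$ such that $c\succeq_V o$ and $[c]\neq[o]$. Then $E^G_X$ is not essentially countable: there are no standard Borel space $Y$, Borel equivalence relation $F\subseteq Y\times Y$ all of whose classes are countable, and Borel map $f\colon X\to Y$ such that for all $x,x'\in X$, $x\,E^G_X\,x'$ if and only if $f(x)\,F\,f(x')$. -/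

import Mathlib

open Filter Topology

universe u v w

/-- `E` Borel reduces to `F`: some Borel map `f` satisfies `x E x' ↔ f x F f x'`. -/
def BorelReduces {X : Type u} {Y : Type v} [MeasurableSpace X] [MeasurableSpace Y]
    (E : Setoid X) (F : Setoid Y) : Prop :=
  ∃ f : X → Y, Measurable f ∧ ∀ x x' : X, E x x' ↔ F (f x) (f x')

/-- `F` is a countable Borel equivalence relation: it is a Borel subset of the square and each
of its classes is countable. -/
def IsCountableBorel {Y : Type v} [MeasurableSpace Y] (F : Setoid Y) : Prop :=
  MeasurableSet {p : Y × Y | F p.1 p.2} ∧ ∀ y : Y, {z : Y | F y z}.Countable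

/-- `E` is essentially countable: it Borel reduces to a countable Borel equivalence relation on
some standard Borel space. The space is sought in an arbitrary universe `v`; the choice of `v` is
immaterial, as a standard Borel space has at most continuum many points. -/
def IsEssentiallyCountable {X : Type u} [MeasurableSpace X] (E : Setoid X) : Prop :=
  ∃ (Y : Type v) (_ : MeasurableSpace Y) (_ : StandardBorelSpace Y) (F : Setoid Y),
    IsCountableBorel F ∧ BorelReduces E F

/-- `y` admits a `V`-approximation from `x`, written `x ⪰_V y`. -/
def Approximates {G : Type u} {X : Type v} [Group G] [MulAction G X] [TopologicalSpace X]
    (V : Set G) (x y : X) : Prop :=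
  ∃ (gStar : G) (g : ℕ → G), (∀ n, g n ∈ V) ∧
    Tendsto (fun n => g n • gStar • x) atTop (𝓝 y)

/-! A reduction `f` to a countable relation takes countably many values on each orbit, so by Baire
category `f` is almost constant on `W • x` for generic `x` in some open `U` and some fixed `W`
(`exists_open_almost_locally_const`). Take `V` with `V * V * V⁻¹ * V⁻¹ ⊆ W` and let `c` approximate
`o`. Small generic shifts of the points `g n • gStar • c` then all have one `f`-value. They come
arbitrarily close to `o`, and `f` is continuous enough on a comeager set
(`exists_residual_separated`) to give `o` this value too. Hence `c` and `o` share an orbit, a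
contradiction. -/

section BaireCategory

variable {α β γ : Type*} [TopologicalSpace α] [TopologicalSpace β]

/-- One direction of the Kuratowski–Ulam theorem: almost every section of a comeager set is
comeager. -/
theorem eventually_eventually_residual_of_prod [SecondCountableTopology α] {P : α × β → Prop}
    (hP : ∀ᶠ p in residual (α × β), P p) :
    ∀ᶠ y in residual β, ∀ᶠ x in residual α, P (x, y) := by
  obtain ⟨S, hSo, hSd, hSc, hS⟩ := mem_residual_iff.1 hP
  have key : ∀ t ∈ S, ∀ᶠ y in residual β, ∀ᶠ x in residual α, (x, y) ∈ t := by
    intro t ht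
    have hb : ∀ b ∈ TopologicalSpace.countableBasis α,
        ∀ᶠ y in residual β, ∃ x ∈ b, (x, y) ∈ t := by
      intro b hb
      have hbo := TopologicalSpace.isOpen_of_mem_countableBasis hb
      have heq : {y : β | ∃ x ∈ b, (x, y) ∈ t} = Prod.snd '' (t ∩ b ×ˢ Set.univ) := by
        ext y
        simp only [Set.mem_ofPred_eq, Set.mem_image, Set.mem_inter_iff, Set.mem_prod,
          Set.mem_univ, and_true, Prod.exists, exists_eq_right]
        exact exists_congr fun x => and_comm
      change {y : β | ∃ x ∈ b, (x, y) ∈ t} ∈ residual β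
      refine residual_of_dense_open ?_ ?_
      · rw [heq]
        exact isOpenMap_snd _ ((hSo t ht).inter (hbo.prod isOpen_univ))
      · refine dense_iff_inter_open.2 fun U hU hUn => ?_
        obtain ⟨⟨x, y⟩, hxy, hxt⟩ := dense_iff_inter_open.1 (hSd t ht) (b ×ˢ U) (hbo.prod hU)
          ((TopologicalSpace.nonempty_of_mem_countableBasis hb).prod hUn)
        exact ⟨y, hxy.2, x, hxy.1, hxt⟩
    filter_upwards [(eventually_countable_ball
      (TopologicalSpace.countable_countableBasis α)).2 hb] with y hy
    refine residual_of_dense_open ((hSo t ht).preimage (Continuous.prodMk_left y)) ?_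
    refine (TopologicalSpace.isBasis_countableBasis α).dense_iff.2 fun b hb _ => ?_
    obtain ⟨x, hxb, hxt⟩ := hy b hb
    exact ⟨x, hxb, hxt⟩
  filter_upwards [(eventually_countable_ball hSc).2 key] with y hy
  filter_upwards [(eventually_countable_ball hSc).2 hy] with x hx
  exact hS hx

/-- The category quantifier over an open set preserves the Baire property. -/
theorem BaireMeasurableSet.setOf_eventually_section [SecondCountableTopology α] [BaireSpace α]
    {S : Set (α × β)} (hS : BaireMeasurableSet S) {V : Set α} (hV : IsOpen V) :
    BaireMeasurableSet {y : β | ∀ᶠ x in residual α, x ∈ V → (x, y) ∈ S} := by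
  obtain ⟨W, hW, hSW⟩ := hS.residualEq_isOpen
  have hcongr : {y : β | ∀ᶠ x in residual α, x ∈ V → (x, y) ∈ W} =ᶠ[residual β]
      {y : β | ∀ᶠ x in residual α, x ∈ V → (x, y) ∈ S} := by
    refine eventuallyEq_set.2 ?_
    filter_upwards [eventually_eventually_residual_of_prod (eventuallyEq_set.1 hSW)] with y hy
    refine eventually_congr ?_
    filter_upwards [hy] with x hx
    rw [hx]
  refine BaireMeasurableSet.congr ?_ hcongr
  -- An open set is comeager in `V` iff it meets every nonempty basic open subset of `V`.
  have heq : {y : β | ∀ᶠ x in residual α, x ∈ V → (x, y) ∈ W} =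
      ⋂ b ∈ {b ∈ TopologicalSpace.countableBasis α | b ⊆ V}, {y : β | ∃ x ∈ b, (x, y) ∈ W} := by
    ext y
    simp only [Set.mem_ofPred_eq, Set.mem_iInter]
    constructor
    · rintro hy b ⟨hb, hbV⟩
      obtain ⟨x, hxb, hx⟩ := dense_iff_inter_open.1 (dense_of_mem_residual hy) b
        (TopologicalSpace.isOpen_of_mem_countableBasis hb)
        (TopologicalSpace.nonempty_of_mem_countableBasis hb)
      exact ⟨x, hxb, hx (hbV hxb)⟩
    · intro hy
      have hsub : {x | (x, y) ∈ W} ∪ (closure V)ᶜ ∈ residual α := by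
        refine residual_of_dense_open
          ((hW.preimage (Continuous.prodMk_left y)).union isClosed_closure.isOpen_compl) ?_
        refine dense_iff_inter_open.2 fun U hU ⟨u, hu⟩ => ?_
        by_cases huV : u ∈ closure V
        · obtain ⟨v, hvU, hvV⟩ := mem_closure_iff.1 huV U hU hu
          obtain ⟨b, hb, -, hbs⟩ :=
            (TopologicalSpace.isBasis_countableBasis α).exists_subset_of_mem_open (⟨hvU, hvV⟩ : v ∈ U ∩ V) (hU.inter hV)
          obtain ⟨x, hxb, hx⟩ := hy b ⟨hb, fun z hz => (hbs hz).2⟩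
          exact ⟨x, (hbs hxb).1, Or.inl hx⟩
        · exact ⟨u, hu, Or.inr huV⟩
      filter_upwards [hsub] with x hx hxV
      exact hx.resolve_right fun hn => hn (subset_closure hxV)
  rw [heq]
  refine BaireMeasurableSet.biInter
    ((TopologicalSpace.countable_countableBasis α).mono fun b hb => hb.1) fun b hb => ?_
  have hbo := TopologicalSpace.isOpen_of_mem_countableBasis hb.1
  have himage : {y : β | ∃ x ∈ b, (x, y) ∈ W} = Prod.snd '' (W ∩ b ×ˢ Set.univ) := by
    ext y
    simp only [Set.mem_ofPred_eq, Set.mem_image, Set.mem_inter_iff, Set.mem_prod,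
      Set.mem_univ, and_true, Prod.exists, exists_eq_right]
    exact exists_congr fun x => and_comm
  rw [himage]
  exact (isOpenMap_snd _ (hW.inter (hbo.prod isOpen_univ))).baireMeasurableSet

/-- A Borel map with countable range is, at almost every point, almost constant on a
neighbourhood. -/
theorem eventually_residual_locally_const [MeasurableSpace α] [BorelSpace α] [MeasurableSpace γ]
    [MeasurableSingletonClass γ] {φ : α → γ} (hφ : Measurable φ) (hc : (Set.range φ).Countable) :
    ∀ᶠ a in residual α, ∃ U : Set α, IsOpen U ∧ a ∈ U ∧
      ∀ᶠ b in residual α, b ∈ U → φ b = φ a := by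
  choose U hU hUeq using fun y : γ =>
    (hφ (measurableSet_singleton y)).residualEq_isOpen
  have hall := (eventually_countable_ball hc).2 fun y _ => eventuallyEq_set.1 (hUeq y)
  filter_upwards [hall] with a ha
  refine ⟨U (φ a), hU _, (ha (φ a) ⟨a, rfl⟩).1 rfl, ?_⟩
  filter_upwards [eventuallyEq_set.1 (hUeq (φ a))] with b hb hbU
  exact hb.2 hbU

/-- A Borel map into a countably separated space is continuous on a comeager set, in the sense
that it is determined there by countably many open sets. -/
theorem exists_residual_separated [MeasurableSpace α] [BorelSpace α] [MeasurableSpace γ]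
    [MeasurableSpace.CountablySeparated γ] {f : α → γ} (hf : Measurable f) :
    ∃ D ∈ residual α, ∀ a ∈ D, ∀ y : γ, f a ≠ y →
      ∃ U : Set α, IsOpen U ∧ a ∈ U ∧ ∀ b ∈ D, b ∈ U → f b ≠ y := by
  obtain ⟨B, hB, hsep⟩ := exists_seq_separating γ MeasurableSet.empty Set.univ
  choose U hU hUeq using fun n => (hf (hB n)).residualEq_isOpen
  -- Complements need their own open sets, since the complement of `U n` need not be open.
  choose U' hU' hUeq' using fun n => (hf (hB n).compl).residualEq_isOpen
  refine ⟨{a | ∀ n, (f a ∈ B n ↔ a ∈ U n) ∧ (f a ∉ B n ↔ a ∈ U' n)}, ?_, ?_⟩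
  · exact eventually_countable_forall.2 fun n =>
      (eventuallyEq_set.1 (hUeq n)).and (eventuallyEq_set.1 (hUeq' n))
  · intro a ha y hne
    have : ∃ n, ¬ (f a ∈ B n ↔ y ∈ B n) := by
      by_contra! hcon
      exact hne (hsep _ trivial _ trivial hcon)
    obtain ⟨n, hn⟩ := this
    by_cases han : f a ∈ B n
    · refine ⟨U n, hU n, (ha n).1.1 han, fun b hb hbU hby => hn ?_⟩
      exact iff_of_true han (hby ▸ (hb n).1.2 hbU)
    · refine ⟨U' n, hU' n, (ha n).2.1 han, fun b hb hbU hby => hn ?_⟩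
      exact iff_of_false han (hby ▸ (hb n).2.2 hbU)

end BaireCategory

section Translation

variable {G : Type*} [Group G] [TopologicalSpace G] [IsTopologicalGroup G]

theorem eventually_residual_mul_right {P : G → Prop} (hP : ∀ᶠ g in residual G, P g) (k : G) :
    ∀ᶠ g in residual G, P (g * k) :=
  tendsto_residual_of_isOpenMap (continuous_mul_const k) (isOpenMap_mul_right k) hP

/-- For a comeager set `D`, almost every point is moved into `D` by almost every group element. -/
theorem eventually_eventually_residual_smul {X : Type*} [SecondCountableTopology G]
    [TopologicalSpace X] [MulAction G X] [ContinuousSMul G X] {D : Set X} (hD : D ∈ residual X) :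
    ∀ᶠ x in residual X, ∀ᶠ g in residual G, g • x ∈ D := by
  refine eventually_eventually_residual_of_prod (P := fun p : G × X => p.1 • p.2 ∈ D) ?_
  -- The action map is this shear followed by a projection, so it is open and pulls comeager sets
  -- back to comeager sets.
  let e : G × X ≃ₜ G × X :=
    { toFun := fun p => (p.1, p.1 • p.2)
      invFun := fun p => (p.1, p.1⁻¹ • p.2)
      left_inv := fun p => by simp
      right_inv := fun p => by simp
      continuous_toFun := by fun_prop
      continuous_invFun := by fun_prop }
  exact tendsto_residual_of_isOpenMap (f := fun p : G × X => p.1 • p.2) continuous_smul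
    (isOpenMap_snd.comp e.isOpenMap) hD

/-- If `f` is Borel with countable range on each orbit, then for some identity neighbourhood `W`
the set of points `x` at which `f` is almost constant along `W • x` is comeager in a nonempty open
set. -/
theorem exists_open_almost_locally_const {X Y : Type*} [PolishSpace G]
    [TopologicalSpace X] [PolishSpace X] [MeasurableSpace X] [BorelSpace X] [Nonempty X]
    [MulAction G X] [ContinuousSMul G X] [MeasurableSpace Y] [StandardBorelSpace Y]
    {f : X → Y} (hf : Measurable f)
    (hc : ∀ x : X, (Set.range fun g : G => f (g • x)).Countable) :
    ∃ W ∈ 𝓝 (1 : G), ∃ U : Set X, IsOpen U ∧ U.Nonempty ∧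
      ∀ᶠ x in residual X, x ∈ U → ∀ᶠ v in residual G, v ∈ W → f (v • x) = f x := by
  borelize G
  obtain ⟨B, hB⟩ := (𝓝 (1 : G)).exists_antitone_basis
  have hO : ∀ n, (1 : G) ∈ interior (B n) := fun n =>
    mem_interior_iff_mem_nhds.2 (hB.1.mem_of_mem trivial)
  let A : ℕ → Set X := fun n => {x | ∀ᶠ v in residual G, v ∈ interior (B n) → f (v • x) = f x}
  have hS : MeasurableSet {p : G × X | f (p.1 • p.2) = f p.2} :=
    measurableSet_eq_fun (hf.comp continuous_smul.measurable) (hf.comp measurable_snd)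
  have hA : ∀ n, BaireMeasurableSet (A n) := fun n =>
    hS.baireMeasurableSet.setOf_eventually_section isOpen_interior
  choose U hU hAU using fun n => (hA n).residualEq_isOpen
  suffices hne : ∃ n, (U n).Nonempty by
    obtain ⟨n, hn⟩ := hne
    refine ⟨interior (B n), isOpen_interior.mem_nhds (hO n), U n, hU n, hn, ?_⟩
    filter_upwards [eventuallyEq_set.1 (hAU n)] with x hx hxU
    exact hx.2 hxU
  -- Otherwise every `A n` is meager, and some `g • x` avoids them all although `f` is almost
  -- constant along the orbit near it.
  by_contra! hcon
  have hempty : {x | ∀ n, x ∉ A n} ∈ residual X :=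
    eventually_countable_forall.2 fun n => by
      filter_upwards [eventuallyEq_set.1 (hAU n)] with x hx
      rw [hx, hcon n]
      exact Set.notMem_empty x
  obtain ⟨x, hx⟩ := (dense_of_mem_residual
    (eventually_eventually_residual_smul (G := G) hempty)).nonempty
  have hφ : Measurable fun g : G => f (g • x) :=
    hf.comp (continuous_id.smul continuous_const).measurable
  obtain ⟨g, hg, V, hV, hgV, hconst⟩ := (dense_of_mem_residual
    (Filter.Eventually.and (p := fun g : G => ∀ n, g • x ∉ A n) hx
      (eventually_residual_locally_const hφ (hc x)))).nonempty
  have hpre : (fun v : G => v * g) ⁻¹' V ∈ 𝓝 (1 : G) :=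
    (hV.preimage (continuous_mul_const g)).mem_nhds (by simpa using hgV)
  obtain ⟨n, -, hn⟩ := hB.1.mem_iff.1 hpre
  refine hg n ?_
  filter_upwards [eventually_residual_mul_right hconst g] with v hv hvB
  rw [← mul_smul]
  exact hv (hn (interior_subset hvB))

end Translation

theorem theorem4p1 {G : Type u} {X : Type w}
    [Group G] [TopologicalSpace G] [IsTopologicalGroup G] [PolishSpace G]
    [TopologicalSpace X] [PolishSpace X] [MeasurableSpace X] [BorelSpace X] [Nonempty X]
    [MulAction G X] [ContinuousSMul G X]
    (h : ∀ V : Set G, IsOpen V → (1 : G) ∈ V →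
      ∀ C : Set X, C ∈ residual X → (∀ g : G, ∀ x ∈ C, g • x ∈ C) →
      ∀ O : Set X, ¬ IsMeagre O →
        ∃ c ∈ C, ∃ o ∈ O, Approximates V c o ∧ MulAction.orbit G c ≠ MulAction.orbit G o) :
    ¬ IsEssentiallyCountable.{w, v} (MulAction.orbitRel G X) := by
  rintro ⟨Y, _, _, F, ⟨-, hFc⟩, f, hf, hred⟩
  have hrange : ∀ x : X, (Set.range fun g : G => f (g • x)).Countable := fun x => by
    refine (hFc (f x)).mono ?_
    rintro _ ⟨g, rfl⟩
    exact (hred _ _).1 (Setoid.symm' _ (MulAction.orbitRel_apply.2 ⟨g, rfl⟩))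
  obtain ⟨W, hW, U, hU, hUn, hA⟩ := exists_open_almost_locally_const (G := G) hf hrange
  obtain ⟨D, hD, hDsep⟩ := exists_residual_separated hf
  -- `K` is the set of points where `f` is well behaved.
  obtain ⟨K, hK, hKD, hKA⟩ : ∃ K ∈ residual X, K ⊆ D ∧
      ∀ x ∈ K, x ∈ U → ∀ᶠ v in residual G, v ∈ W → f (v • x) = f x :=
    ⟨D ∩ {x | x ∈ U → ∀ᶠ v in residual G, v ∈ W → f (v • x) = f x}, inter_mem hD hA,
      Set.inter_subset_left, fun x hx => hx.2⟩
  have hlim : Tendsto (fun p : G × G × G × G => p.1 * p.2.1 * p.2.2.1⁻¹ * p.2.2.2⁻¹)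
      (𝓝 ((1 : G), (1 : G), (1 : G), (1 : G))) (𝓝 1) :=
    Continuous.tendsto' (by fun_prop) _ _ (by simp)
  obtain ⟨V, hVo, hV1, hVW⟩ : ∃ V : Set G, IsOpen V ∧ (1 : G) ∈ V ∧
      ∀ a ∈ V, ∀ b ∈ V, ∀ c ∈ V, ∀ d ∈ V, a * b * c⁻¹ * d⁻¹ ∈ W := by
    have := hlim hW
    simp only [nhds_prod_eq, Filter.mem_map] at this
    obtain ⟨T, hT, hTs⟩ : ∃ T ∈ 𝓝 (1 : G), T ×ˢ T ×ˢ T ×ˢ T ⊆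
        (fun p : G × G × G × G => p.1 * p.2.1 * p.2.2.1⁻¹ * p.2.2.2⁻¹) ⁻¹' W := by
      obtain ⟨T₁, h₁, R₁, hR₁, hs₁⟩ := mem_prod_iff.1 this
      obtain ⟨T₂, h₂, R₂, hR₂, hs₂⟩ := mem_prod_iff.1 hR₁
      obtain ⟨T₃, h₃, T₄, h₄, hs₃⟩ := mem_prod_iff.1 hR₂
      refine ⟨T₁ ∩ T₂ ∩ (T₃ ∩ T₄), inter_mem (inter_mem h₁ h₂) (inter_mem h₃ h₄), ?_⟩
      rintro ⟨a, b, c, d⟩ ⟨ha, hb, hc, hd⟩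
      exact hs₁ ⟨ha.1.1, hs₂ ⟨hb.1.2, hs₃ ⟨hc.2.1, hd.2.2⟩⟩⟩
    obtain ⟨V, hVT, hVo, hV1⟩ := mem_nhds_iff.1 hT
    exact ⟨V, hVo, hV1, fun a ha b hb c hc d hd =>
      hTs (⟨hVT ha, hVT hb, hVT hc, hVT hd⟩ : (a, b, c, d) ∈ T ×ˢ T ×ˢ T ×ˢ T)⟩
  have hOn : ¬ IsMeagre (U ∩ K) := fun hm => by
    refine not_isMeagre_of_isOpen hU hUn ?_
    refine (hm.union (?_ : IsMeagre Kᶜ)).mono fun x hx => ?_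
    · simpa [IsMeagre] using hK
    · by_cases hxK : x ∈ K
      · exact Or.inl ⟨hx, hxK⟩
      · exact Or.inr hxK
  -- `K` need not be invariant; the set of points with almost all translates in `K` is.
  obtain ⟨c, hc, o, ⟨hoU, hoK⟩, ⟨gs, g, hgV, hgo⟩, hne⟩ :=
    h V hVo hV1 {x | ∀ᶠ k in residual G, k • x ∈ K} (eventually_eventually_residual_smul hK)
      (fun k x hx => by
        filter_upwards [eventually_residual_mul_right hx k] with l hl
        rwa [← mul_smul]) (U ∩ K) hOn
  -- Near the identity, almost every `k` moves a point `l • c` of an open set `Q` into `Q ∩ K`.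
  have hmove : ∀ (l : G) (Q : Set X), IsOpen Q → l • c ∈ Q → ∀ P : G → Prop,
      (∀ᶠ k in residual G, P k) → ∃ k ∈ V, k • l • c ∈ Q ∧ k • l • c ∈ K ∧ P k := by
    intro l Q hQ hlQ P hP
    have hKl : ∀ᶠ k in residual G, k • l • c ∈ K := by
      filter_upwards [eventually_residual_mul_right hc l] with k hk
      rwa [← mul_smul]
    have hcont : Continuous fun k : G => k • l • c := continuous_id.smul continuous_const
    obtain ⟨k, hk, hkK, hkP⟩ := dense_iff_inter_open.1 (dense_of_mem_residual (hKl.and hP))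
      (V ∩ (fun k : G => k • l • c) ⁻¹' Q) (hVo.inter (hQ.preimage hcont))
      ⟨1, hV1, by simpa using hlQ⟩
    exact ⟨k, hk.1, hk.2, hkK, hkP⟩
  simp only [← mul_smul] at hgo
  obtain ⟨n, hn⟩ := (hgo.eventually (hU.mem_nhds hoU)).exists
  obtain ⟨k, hkV, hkU, hkK, -⟩ := hmove _ U hU hn (fun _ => True)
    (Eventually.of_forall fun _ => trivial)
  have hconst := hKA _ hkK hkU
  have hfo : f o = f (k • (g n * gs) • c) := by
    by_contra hcon
    obtain ⟨Q, hQ, hoQ, hQs⟩ := hDsep o (hKD hoK) _ hcon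
    obtain ⟨m, hm⟩ := (hgo.eventually (hQ.mem_nhds hoQ)).exists
    -- `k' * g m * (g n)⁻¹ * k⁻¹ ∈ W` carries the reference point `k • (g n * gs) • c` to `k' • (g m
    -- * gs) • c`.
    obtain ⟨k', hk'V, hk'Q, hk'K, hk'P⟩ := hmove _ Q hQ hm _
      (eventually_residual_mul_right hconst (g m * (g n)⁻¹ * k⁻¹))
    refine hQs _ (hKD hk'K) hk'Q ?_
    rw [← hk'P (by simpa only [mul_assoc] using hVW k' hk'V _ (hgV m) _ (hgV n) k hkV)]
    congr 1
    simp only [← mul_smul]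
    congr 1
    group
  have hrel : MulAction.orbitRel G X o (k • (g n * gs) • c) := by
    rw [hred, hfo]
  apply hne
  have := MulAction.orbit_eq_iff.2 (MulAction.orbitRel_apply.1 hrel)
  rw [this, MulAction.orbit_smul, MulAction.orbit_smul]
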